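/- Let $\kappa$ be an uncountable cardinal. Let ${}^{<\kappa}\square\,2^\kappa$ be the set of all functions $\kappa\to\{0,1\}$ with the $(<\kappa)$-box topology, whose base consists of the sets $\prod_{\alpha<\kappa}O_\alpha$ with $O_\alpha\subseteq\{0,1\}$ and $|\{\alpha<\kappa : O_\alpha\neq\{0,1\}\}|<\kappa$. Call a topological space $(<\kappa)$-compact if every open cover of it has a subcover of size $<\kappa$. Then $\kappa$ is weakly compact (that is, $\kappa$ is uncountable and $\kappa\to(\kappa)^2_2$: for every colouring of the two-element subsets of $\kappa$ with two colours there is a set $H\subseteq\kappa$ of size $\kappa$ all of whose two-element subsets have the same colour) if and only if ${}^{<\kappa}\square\,2^\kappa$ is $(<\kappa)$-compact. -/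

import Mathlib

universe u v

namespace MiddleBox

/-- The set `∏ᵢ Xᵢ` with the `(<κ)`-box topology (see the instance below). -/
def BoxProduct (_κ : Cardinal.{u}) {ι : Type u} (X : ι → Type v) : Type (max u v) :=
  ∀ i, X i

/-- The `(<κ)`-open boxes: the sets `∏ᵢ Oᵢ` where every `Oᵢ` is open in `Xᵢ` and
fewer than `κ` of the `Oᵢ` differ from the whole of `Xᵢ`. -/
def openBoxes (κ : Cardinal.{u}) {ι : Type u} (X : ι → Type v)
    [∀ i, TopologicalSpace (X i)] : Set (Set (BoxProduct κ X)) :=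
  {B | ∃ O : ∀ i, Set (X i), (∀ i, IsOpen (O i)) ∧
    Cardinal.mk {i : ι // O i ≠ Set.univ} < κ ∧ B = {x | ∀ i, x i ∈ O i}}

/-- The `(<κ)`-box topology, generated by the `(<κ)`-open boxes (which form a base of it when
`κ` is infinite, see `isTopologicalBasis_openBoxes`). -/
instance (κ : Cardinal.{u}) {ι : Type u} (X : ι → Type v)
    [∀ i, TopologicalSpace (X i)] : TopologicalSpace (BoxProduct κ X) :=
  TopologicalSpace.generateFrom (openBoxes κ X)

theorem isTopologicalBasis_openBoxes {κ : Cardinal.{u}} (hκ : Cardinal.aleph0 ≤ κ) {ι : Type u}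
    (X : ι → Type v) [∀ i, TopologicalSpace (X i)] :
    TopologicalSpace.IsTopologicalBasis (openBoxes κ X) where
  exists_subset_inter := by
    rintro _ ⟨O, hO, hcO, rfl⟩ _ ⟨P, hP, hcP, rfl⟩ x ⟨hxO, hxP⟩
    refine ⟨_, ⟨fun i => O i ∩ P i, fun i => (hO i).inter (hP i), ?_, rfl⟩,
      fun i => ⟨hxO i, hxP i⟩, fun y hy => ⟨fun i => (hy i).1, fun i => (hy i).2⟩⟩
    have hsub : {i | O i ∩ P i ≠ Set.univ} ⊆ {i | O i ≠ Set.univ} ∪ {i | P i ≠ Set.univ} := by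
      intro i hi
      by_contra h
      simp only [Set.mem_union, Set.mem_ofPred_eq, not_or, not_not] at h
      exact hi (by rw [h.1, h.2, Set.inter_univ])
    exact ((Cardinal.mk_le_mk_of_subset hsub).trans (Cardinal.mk_union_le _ _)).trans_lt
      (Cardinal.add_lt_of_lt hκ hcO hcP)
  sUnion_eq := by
    refine Set.eq_univ_of_forall fun x => Set.mem_sUnion.2 ⟨{y | ∀ i, y i ∈ (Set.univ : Set (X i))},
      ⟨fun _ => Set.univ, fun _ => isOpen_univ, ?_, rfl⟩, fun i => Set.mem_univ (x i)⟩
    have : IsEmpty {i : ι // (Set.univ : Set (X i)) ≠ Set.univ} := ⟨fun i => i.2 rfl⟩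
    rw [Cardinal.mk_eq_zero]
    exact Cardinal.aleph0_pos.trans_le hκ
  eq_generateFrom := rfl

/-- A space is `(<κ)`-compact if every open cover has a subcover of size `< κ`. -/
def IsLTCompact (κ : Cardinal.{u}) (X : Type u) [TopologicalSpace X] : Prop :=
  ∀ U : Set (Set X), (∀ O ∈ U, IsOpen O) → ⋃₀ U = Set.univ →
    ∃ V : Set (Set X), V ⊆ U ∧ Cardinal.mk V < κ ∧ ⋃₀ V = Set.univ

/-- `κ` is weakly compact: it is uncountable and satisfies the partition relation `κ → (κ)²₂`,
i.e. every colouring of the two-element subsets of `κ` with two colours has a homogeneous set of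
size `κ`. (The values of the colouring at the diagonal elements `s(x, x)` play no role.) -/
def IsWeaklyCompact (κ : Cardinal.{u}) : Prop :=
  Cardinal.aleph0 < κ ∧
    ∀ c : Sym2 κ.ord.ToType → Bool, ∃ H : Set κ.ord.ToType, Cardinal.mk H = κ ∧
      ∃ b : Bool, ∀ x ∈ H, ∀ y ∈ H, x ≠ y → c s(x, y) = b

end MiddleBox

namespace MiddleBox

open Cardinal

/-! Compactness gives a point `x` such that, on any small set of coordinates, `x` agrees with a row
`i ↦ c s(i, j)` for some new `j`: otherwise fewer than `κ` neighbourhoods would catch all rows, and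
regularity (`exists_forall_notMem`) gives a `j` escaping them. A maximal homogeneous set built along
`x` then has size `κ`. Conversely, colouring pairs by lexicographic order makes every `κ`-sequence
of points converge along a set of size `κ` (`exists_eventually_agree`). This yields the strong limit
property, hence at most `κ` cylinders, and a limit of points escaping more and more of them refutes
a bad cover. -/

theorem isOpen_setOf_agree {κ : Cardinal.{u}} {ι : Type u} (S : Set ι) (hS : #S < κ)
    (x : ι → Bool) :
    IsOpen {y : BoxProduct κ (fun _ : ι => Bool) | ∀ i ∈ S, y i = x i} := by
  refine TopologicalSpace.isOpen_generateFrom_of_mem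
    ⟨fun i => {b | i ∈ S → b = x i}, fun i => isOpen_discrete _, ?_, ?_⟩
  · refine (mk_le_mk_of_subset (s := {i | {b : Bool | i ∈ S → b = x i} ≠ Set.univ}) (t := S)
      fun i hi => ?_).trans_lt hS
    by_contra h
    exact hi (Set.eq_univ_of_forall fun b hb => (h hb).elim)
  · rfl

/-! ### From compactness to the partition relation -/

/-- Compactness of `2^ι` applied to a cover by basic neighbourhoods of the points. -/
theorem IsLTCompact.exists_agree {κ : Cardinal.{u}} {ι : Type u}
    (h : IsLTCompact κ (BoxProduct κ (fun _ : ι => Bool)))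
    (S : (ι → Bool) → Set ι) (hS : ∀ x, #(S x) < κ) :
    ∃ W : Set (ι → Bool), #W < κ ∧ ∀ y : ι → Bool, ∃ x ∈ W, ∀ i ∈ S x, y i = x i := by
  let N : (ι → Bool) → Set (BoxProduct κ (fun _ : ι => Bool)) :=
    fun x => {y | ∀ i ∈ S x, y i = x i}
  obtain ⟨V, hVU, hV, hcov⟩ := h (Set.range N)
    (by rintro _ ⟨x, rfl⟩; exact isOpen_setOf_agree _ (hS x) x)
    (Set.eq_univ_of_forall fun x => ⟨N x, ⟨x, rfl⟩, fun _ _ => rfl⟩)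
  choose p hp using fun O : V => hVU O.2
  refine ⟨Set.range p, mk_range_le.trans_lt hV, fun y => ?_⟩
  obtain ⟨O, hO, hy⟩ : y ∈ ⋃₀ V := hcov ▸ Set.mem_univ _
  refine ⟨_, ⟨⟨O, hO⟩, rfl⟩, ?_⟩
  have : y ∈ N (p ⟨O, hO⟩) := by rw [hp]; exact hy
  exact this

/-- If `2^κ` is `(<κ)`-compact, then `κ` is regular. -/
theorem IsLTCompact.exists_forall_notMem {κ : Cardinal.{u}} (hκ : ℵ₀ ≤ κ) {ι : Type u}
    (hι : #ι = κ) (h : IsLTCompact κ (BoxProduct κ (fun _ : ι => Bool)))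
    {W : Type u} (hW : #W < κ) (A : W → Set ι) (hA : ∀ w, #(A w) < κ) :
    ∃ i, ∀ w, i ∉ A w := by
  classical
  by_contra! hcov
  choose w hw using hcov
  obtain ⟨e⟩ : Nonempty (W ↪ ι) := Cardinal.le_def _ _ |>.1 (hι ▸ hW.le)
  have hre : #(Set.range e) < κ := mk_range_le.trans_lt hW
  -- A point codes `w` when `e w` is its only true coordinate on `Set.range e`; its neighbourhood
  -- then also fixes `A w`.
  let D : (ι → Bool) → Set ι := fun x =>
    Set.range e ∪ {a | ∃ w, (∀ v, x (e v) = true ↔ v = w) ∧ a ∈ A w}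
  have hD : ∀ x, #(D x) < κ := by
    intro x
    refine (mk_union_le _ _).trans_lt (add_lt_of_lt hκ hre ?_)
    by_cases hx : ∃ w, ∀ v, x (e v) = true ↔ v = w
    · obtain ⟨w, hw⟩ := hx
      refine (mk_le_mk_of_subset ?_).trans_lt (hA w)
      rintro a ⟨w', hw', ha⟩
      rwa [← (hw' w).1 ((hw w).2 rfl)] at ha
    · refine (mk_le_mk_of_subset (t := Set.range e) ?_).trans_lt hre
      rintro a ⟨w', hw', -⟩
      exact (hx ⟨w', hw'⟩).elim
  obtain ⟨P, hP, hPc⟩ := h.exists_agree D hD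
  -- The code of `w i` with an extra mark at `i ∈ A (w i)`: the centre chosen for `y i` must show
  -- that mark, so different `i` outside `Set.range e` need different centres.
  let y : ι → ι → Bool := fun i a => decide (a = e (w i) ∨ a = i)
  choose p hpP hp using fun i => hPc (y i)
  have hpat : ∀ i ∉ Set.range e, ∀ v, p i (e v) = true ↔ v = w i := by
    intro i hi v
    rw [← hp i (e v) (Or.inl ⟨v, rfl⟩)]
    have : e v ≠ i := fun h => hi ⟨v, h⟩
    simp [y, this]
  have hinj : Function.Injective
      (fun i : ((Set.range e)ᶜ : Set ι) => (⟨p i, hpP i⟩ : P)) := by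
    rintro ⟨i, hi⟩ ⟨j, hj⟩ hij
    have hij : p i = p j := congrArg Subtype.val hij
    have hwij : w i = w j := by
      have := (hpat i hi (w i)).2 rfl
      rw [hij] at this
      exact (hpat j hj _).1 this
    have h1 : p i i = true := by
      rw [← hp i i (Or.inr ⟨w i, hpat i hi, hw i⟩)]
      simp [y]
    have h2 : y j i = true := by
      rw [hp j i (Or.inr ⟨w j, hpat j hj, hwij ▸ hw i⟩), ← hij, h1]
    have h3 : i ≠ e (w j) := fun h => hi ⟨_, h.symm⟩
    simpa [y, h3] using h2
  have : Infinite ι := infinite_iff.2 (hι ▸ hκ)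
  have hcompl := mk_compl_of_infinite (Set.range e) (hι ▸ hre)
  exact ((mk_le_of_injective hinj).trans_lt hP).ne (hcompl.trans hι)

theorem exists_homogeneous_of_isLTCompact {κ : Cardinal.{u}} (hκ : ℵ₀ ≤ κ) {ι : Type u}
    (hι : #ι = κ) (h : IsLTCompact κ (BoxProduct κ (fun _ : ι => Bool))) (c : Sym2 ι → Bool) :
    ∃ H : Set ι, #H = κ ∧ ∃ b : Bool, ∀ x ∈ H, ∀ y ∈ H, x ≠ y → c s(x, y) = b := by
  obtain ⟨x, hx⟩ : ∃ x : ι → Bool, ∀ S : Set ι, #S < κ →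
      ∃ j ∉ S, ∀ i ∈ S, c s(i, j) = x i := by
    by_contra! hno
    choose S hS hSx using hno
    obtain ⟨W, hW, hWc⟩ := h.exists_agree S hS
    obtain ⟨j, hj⟩ := h.exists_forall_notMem hκ hι hW (fun x => S x.1) (fun x => hS x.1)
    obtain ⟨x, hxW, hx⟩ := hWc fun i => c s(i, j)
    obtain ⟨i, hi, hne⟩ := hSx x j (hj ⟨x, hxW⟩)
    exact hne (hx i hi)
  -- If both colours failed, the union of their two witnesses would contradict `hx`.
  obtain ⟨b, hb⟩ : ∃ b : Bool, ∀ S : Set ι, #S < κ →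
      ∃ j ∉ S, x j = b ∧ ∀ i ∈ S, c s(i, j) = x i := by
    by_contra! hno
    choose S hS hSx using hno
    obtain ⟨j, hj, hjx⟩ := hx (S true ∪ S false)
      ((mk_union_le _ _).trans_lt (add_lt_of_lt hκ (hS _) (hS _)))
    have key : ∀ b, S b ⊆ S true ∪ S false := by
      rintro (_ | _)
      exacts [Set.subset_union_right, Set.subset_union_left]
    obtain ⟨i, hi, hne⟩ := hSx (x j) j (fun h => hj (key _ h)) rfl
    exact hne (hjx i (key _ hi))
  obtain ⟨H, hH⟩ := zorn_subset
    {H : Set ι | (∀ i ∈ H, x i = b) ∧ ∀ i ∈ H, ∀ j ∈ H, i ≠ j → c s(i, j) = b} (by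
      intro C hC hchain
      refine ⟨⋃₀ C, ⟨?_, ?_⟩, fun s hs => Set.subset_sUnion_of_mem hs⟩
      · rintro i ⟨s, hs, hi⟩
        exact (hC hs).1 i hi
      · rintro i ⟨s, hs, hi⟩ j ⟨t, ht, hj⟩ hij
        rcases hchain.total hs ht with hst | hts
        · exact (hC ht).2 i (hst hi) j hj hij
        · exact (hC hs).2 i hi j (hts hj) hij)
  refine ⟨H, le_antisymm (hι ▸ mk_set_le H) (not_lt.1 fun hlt => ?_), b, hH.prop.2⟩
  obtain ⟨j, hjH, hjb, hj⟩ := hb H hlt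
  refine hjH (hH.le_of_ge (y := insert j H) ⟨?_, ?_⟩ (Set.subset_insert _ _)
    (Set.mem_insert _ _))
  · rintro i (rfl | hi)
    exacts [hjb, hH.prop.1 i hi]
  · rintro i (rfl | hi) k (rfl | hk) hik
    · exact (hik rfl).elim
    · rw [Sym2.eq_swap, hj k hk, hH.prop.1 k hk]
    · rw [hj i hi, hH.prop.1 i hi]
    · exact hH.prop.2 i hi k hk hik

/-! ### From the partition relation to compactness -/

theorem mk_Iic_lt {κ : Cardinal.{u}} (hκ : ℵ₀ ≤ κ) (a : κ.ord.ToType) : #(Set.Iic a) < κ := by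
  have := noMaxOrder hκ
  obtain ⟨b, hb⟩ := exists_gt a
  have h := mk_Iio_lt b (by simp)
  rw [mk_ord_toType] at h
  exact (mk_le_mk_of_subset fun i (hi : i ≤ a) => hi.trans_lt hb).trans_lt h

theorem exists_mem_gt_of_mk_eq {κ : Cardinal.{u}} (hκ : ℵ₀ ≤ κ) {H : Set κ.ord.ToType}
    (hH : #H = κ) (a : κ.ord.ToType) : ∃ b ∈ H, a < b := by
  by_contra! h
  exact ((mk_le_mk_of_subset h).trans_lt (mk_Iic_lt hκ a)).ne hH

namespace IsWeaklyCompact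

variable {κ : Cardinal.{u}}

/-- A weakly compact cardinal is regular. -/
theorem exists_forall_lt (h : IsWeaklyCompact κ) {W : Type u} (hW : #W < κ)
    (f : W → κ.ord.ToType) : ∃ a, ∀ w, f w < a := by
  classical
  by_contra! hno
  choose g hg using hno
  -- One colour makes `g` injective on `H`, impossible in the small `W`; the other makes `g`
  -- constant, so a single value of `f` bounds `H`.
  obtain ⟨H, hH, b, hb⟩ := h.2 (Sym2.lift ⟨fun i j => decide (g i = g j), fun i j => by
    simp [eq_comm]⟩)
  simp only [Sym2.lift_mk] at hb
  cases b
  · have hinj : Function.Injective (fun i : H => g i) := by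
      intro i j hij
      by_contra hne
      exact of_decide_eq_false (hb i i.2 j j.2 fun h => hne (Subtype.ext h)) hij
    exact ((mk_le_of_injective hinj).trans_lt hW).ne hH
  · obtain ⟨i, hi⟩ : H.Nonempty := by
      rw [← Set.nonempty_coe_sort, ← mk_ne_zero_iff, hH]
      exact (aleph0_pos.trans h.1).ne'
    obtain ⟨j, hj, hij⟩ := exists_mem_gt_of_mk_eq h.1.le hH (max i (f (g i)))
    have hne := (le_max_left _ _).trans_lt hij
    have heq : g i = g j := of_decide_eq_true (hb i hi j hj hne.ne)
    exact (hg j).not_gt (heq ▸ (le_max_right _ _).trans_lt hij)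

/-- Along a set of size `κ` on which a sequence of points of `2^ι` is lexicographically
monotone, any fewer than `κ` coordinates are eventually constant. -/
theorem exists_eventually_agree (h : IsWeaklyCompact κ) {ι : Type u} [LinearOrder ι]
    [WellFoundedLT ι] (hι : ∀ i : ι, #(Set.Iio i) < κ) (x : κ.ord.ToType → ι → Bool) :
    ∃ H : Set κ.ord.ToType, #H = κ ∧ ∃ z : ι → Bool, ∀ S : Set ι, #S < κ →
      ∃ a, ∀ b ∈ H, a ≤ b → ∀ i ∈ S, x b i = z i := by
  classical
  let F : κ.ord.ToType → κ.ord.ToType → Prop := fun a b =>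
    ∃ i, (∀ j < i, x a j = x b j) ∧ x a i = false ∧ x b i = true
  obtain ⟨H, hH, t, ht⟩ := h.2 (Sym2.lift ⟨fun a b => decide (F (min a b) (max a b)),
    fun a b => by simp only [min_comm, max_comm]⟩)
  simp only [Sym2.lift_mk] at ht
  have hmono : ∀ a ∈ H, ∀ b ∈ H, a < b → ∀ i, (∀ j < i, x a j = x b j) →
      x a i ≠ x b i → x b i = t := by
    intro a ha b hb hab i hlow hne
    have hc := ht a ha b hb hab.ne
    rw [min_eq_left hab.le, max_eq_right hab.le] at hc
    cases t
    · by_contra hbi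
      rw [Bool.not_eq_false] at hbi
      exact of_decide_eq_false hc ⟨i, hlow, by simpa [hbi] using hne, hbi⟩
    · obtain ⟨k, hk, hak, hbk⟩ := of_decide_eq_true hc
      rcases lt_trichotomy i k with hik | rfl | hik
      · exact (hne (hk i hik)).elim
      · exact hbk
      · have := hlow k hik
        simp [hak, hbk] at this
  have uniform : ∀ (S : Set ι) (z : ι → Bool), #S < κ →
      (∀ i ∈ S, ∃ a, ∀ b ∈ H, a ≤ b → x b i = z i) →
      ∃ a, ∀ b ∈ H, a ≤ b → ∀ i ∈ S, x b i = z i := by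
    intro S z hS hz
    choose f hf using fun i : S => hz i i.2
    obtain ⟨a, ha⟩ := h.exists_forall_lt hS f
    exact ⟨a, fun b hb hab i hi => hf ⟨i, hi⟩ b hb ((ha _).le.trans hab)⟩
  have hconst : ∀ i, ∃ v : Bool, ∃ a, ∀ b ∈ H, a ≤ b → x b i = v := by
    intro i
    induction i using WellFoundedLT.induction with
    | ind i ih =>
      choose! z hz using ih
      obtain ⟨a, ha⟩ := uniform (Set.Iio i) z (hι i) hz
      -- Beyond `a` the coordinates below `i` are settled, so by `hmono` coordinate `i` can change
      -- only to `t`.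
      by_cases hex : ∃ b ∈ H, a ≤ b ∧ x b i = t
      · obtain ⟨b, hb, hab, hbt⟩ := hex
        refine ⟨t, b, fun c hc hbc => ?_⟩
        rcases hbc.eq_or_lt with rfl | hlt
        · exact hbt
        · by_contra hct
          exact hct (hmono b hb c hc hlt i
            (fun j hj => (ha b hb hab j hj).trans (ha c hc (hab.trans hbc) j hj).symm)
            fun heq => hct (heq ▸ hbt))
      · push Not at hex
        exact ⟨!t, a, fun b hb hab => Bool.eq_not_of_ne (hex b hb hab)⟩
  choose z hz using hconst
  exact ⟨H, hH, z, fun S hS => uniform S z hS fun i _ => hz i⟩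

/-- A weakly compact cardinal is a strong limit. -/
theorem mk_arrow_bool_lt (h : IsWeaklyCompact κ) {L : Type u} (hL : #L < κ) :
    #(L → Bool) < κ := by
  by_contra! hle
  rw [← mk_ord_toType κ, Cardinal.le_def] at hle
  obtain ⟨x⟩ := hle
  obtain ⟨_, _⟩ := exists_wellFoundedLT L
  obtain ⟨H, hH, z, hz⟩ := h.exists_eventually_agree
    (fun i : L => (mk_set_le _).trans_lt hL) x
  -- All of `L` is small, so the distinct points `x b` would eventually coincide.
  obtain ⟨a, ha⟩ := hz Set.univ (by simpa using hL)
  obtain ⟨b, hb, hab⟩ := exists_mem_gt_of_mk_eq h.1.le hH a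
  obtain ⟨c, hc, hbc⟩ := exists_mem_gt_of_mk_eq h.1.le hH b
  refine hbc.ne (x.injective (funext fun i => ?_))
  rw [ha b hb hab.le i trivial, ha c hc (hab.trans hbc).le i trivial]

theorem isLTCompact (h : IsWeaklyCompact κ) :
    IsLTCompact κ (BoxProduct κ (fun _ : κ.ord.ToType => Bool)) := by
  intro U hU hcov
  by_contra! hno
  have hIio : ∀ a : κ.ord.ToType, #(Set.Iio a) < κ := fun a =>
    (mk_le_mk_of_subset Set.Iio_subset_Iic_self).trans_lt (mk_Iic_lt h.1.le a)
  -- Cylinders over initial segments lying inside some member of the cover.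
  let B := {p : Σ a : κ.ord.ToType, Set.Iio a → Bool // ∃ O ∈ U,
    ∀ y : BoxProduct κ (fun _ : κ.ord.ToType => Bool),
      (∀ i : Set.Iio p.1, y i = p.2 i) → y ∈ O}
  have hB : #B ≤ κ := calc
    #B ≤ #(Σ a : κ.ord.ToType, Set.Iio a → Bool) := mk_subtype_le _
    _ ≤ sum fun _ : κ.ord.ToType => κ := by
      rw [mk_sigma]
      exact sum_le_sum _ _ fun a => (h.mk_arrow_bool_lt (hIio a)).le
    _ = κ := by rw [sum_const', mk_ord_toType, mul_eq_self h.1.le]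
  rw [← mk_ord_toType κ, Cardinal.le_def] at hB
  obtain ⟨e⟩ := hB
  choose O hOU hO using fun p : B => p.2
  -- Each `x` avoids the cylinders numbered below `a`, as these give no subcover.
  have hx : ∀ a, ∃ x : κ.ord.ToType → Bool, ∀ p : B, e p < a →
      ∃ i : Set.Iio p.1.1, x i ≠ p.1.2 i := by
    intro a
    by_contra! hcon
    have hcard : #{p : B // e p < a} < κ :=
      (mk_le_of_injective (f := fun p => (⟨e p.1, p.2⟩ : Set.Iio a))
        fun p q hpq => Subtype.ext (e.injective (congrArg Subtype.val hpq))).trans_lt (hIio a)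
    refine hno (Set.range fun p : {p : B // e p < a} => O p.1)
      (by rintro _ ⟨p, rfl⟩; exact hOU _) (mk_range_le.trans_lt hcard)
      (Set.eq_univ_of_forall fun y => ?_)
    obtain ⟨p, hp, hy⟩ := hcon y
    exact ⟨_, ⟨⟨p, hp⟩, rfl⟩, hO p y hy⟩
  choose x hx using hx
  obtain ⟨H, hH, z, hz⟩ := h.exists_eventually_agree hIio x
  obtain ⟨G, hG, hzG⟩ :
      (z : BoxProduct κ (fun _ : κ.ord.ToType => Bool)) ∈ ⋃₀ U := hcov ▸ Set.mem_univ _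
  obtain ⟨_, ⟨Q, -, hQ, rfl⟩, hzQ, hQG⟩ :=
    (isTopologicalBasis_openBoxes h.1.le _).exists_subset_of_mem_open hzG (hU G hG)
  obtain ⟨a, ha⟩ := h.exists_forall_lt hQ Subtype.val
  let p : B := ⟨⟨a, fun i => z i⟩, G, hG, fun y hy => hQG fun i => by
    by_cases hi : Q i = Set.univ
    · rw [hi]; trivial
    · have := hy ⟨i, ha ⟨i, hi⟩⟩
      rw [this]
      exact hzQ i⟩
  obtain ⟨b, hb⟩ := hz (Set.Iio a) (hIio a)
  obtain ⟨c, hc, hbc⟩ := exists_mem_gt_of_mk_eq h.1.le hH (max b (e p))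
  obtain ⟨i, hi⟩ := hx c p ((le_max_right _ _).trans_lt hbc)
  exact hi (hb c hc ((le_max_left _ _).trans hbc.le) i i.2)

end IsWeaklyCompact

end MiddleBox

/-- An uncountable cardinal `κ` is weakly compact iff the power `2^κ` of the discrete two-point
space, with the `(<κ)`-box topology, is `(<κ)`-compact. -/
theorem mainTheorem12 (κ : Cardinal.{u}) (hκ : Cardinal.aleph0 < κ) :
    MiddleBox.IsWeaklyCompact κ ↔
      MiddleBox.IsLTCompact κ (MiddleBox.BoxProduct κ (fun _ : κ.ord.ToType => Bool)) :=
  ⟨fun h => h.isLTCompact, fun h => ⟨hκ,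
    MiddleBox.exists_homogeneous_of_isLTCompact hκ.le (Cardinal.mk_ord_toType κ) h⟩⟩
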